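/- For a locally compact Hausdorff space $X$, let $C_0(X)$ be the space of continuous functions $X\to\mathbb C$ vanishing at infinity, and let $M(X)$ be the space of regular complex Borel measures on $X$ with the total variation norm $\|\mu\|=|\mu|(X)$. The $w^*$-topology on $M(X)\cong C_0(X)^*$ is the coarsest topology making $\mu\mapsto\int_X g\,d\mu$ continuous for every $g\in C_0(X)$. Let $X$ and $Y$ be locally compact Hausdorff spaces. Let $SC_0(X\times Y)$ be the space, with the supremum norm, of all bounded functions $f:X\times Y\to\mathbb C$ such that $f(x,\cdot)\in C_0(Y)$ for every $x\in X$ and $f(\cdot,y)\in C_0(X)$ for every $y\in Y$. Let $\mathcal L_{w^*}(M(X),M(Y);\mathbb C)$ be the space of all bounded bilinear forms $\Phi:M(X)\times M(Y)\to\mathbb C$ that are $w^*$-continuous in each variable separately, with the norm $\|\Phi\|=\sup\{|\Phi(\mu,\nu)|:\|\mu\|\le 1,\ \|\nu\|\le 1\}$. **Proposition.** For all $f\in SC_0(X\times Y)$, $\mu\in M(X)$ and $\nu\in M(Y)$, the function $f(\cdot,y)$ is $\mu$-integrable for every $y\in Y$, the function $y\mapsto\int_X f(x,y)\,d\mu(x)$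 is $\nu$-integrable, and $$SC_0(X\times Y)\to\mathcal L_{w^*}(M(X),M(Y);\mathbb C),\qquad f\mapsto\Phi_f,\qquad \Phi_f(\mu,\nu)=\int_Y\int_X f(x,y)\,d\mu(x)\,d\nu(y),$$ is a well-defined linear isometric isomorphism (in particular, it is surjective). -/

import Mathlib

set_option maxSynthPendingDepth 3

open MeasureTheory Filter Topology
open scoped ENNReal NNReal ZeroAtInfty

noncomputable section

namespace SepC0

section Measures

/-- The total variation of a complex measure is a finite measure. -/
theorem isFiniteMeasure_variation {X : Type*} [MeasurableSpace X] (μ : ComplexMeasure X) :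
    IsFiniteMeasure μ.variation := by
  have h : μ.variation ≤
      (ComplexMeasure.re μ).variation + (ComplexMeasure.im μ).variation := by
    apply VectorMeasure.variation_le_of_forall_enorm_le
    intro E _
    have h1 := VectorMeasure.enorm_measure_le_variation (ComplexMeasure.re μ) E
    have h2 := VectorMeasure.enorm_measure_le_variation (ComplexMeasure.im μ) E
    refine le_trans ?_ (add_le_add h1 h2)
    rw [ComplexMeasure.re_apply, ComplexMeasure.im_apply,
      enorm_eq_nnnorm, enorm_eq_nnnorm, enorm_eq_nnnorm]
    have h3 : ‖μ E‖₊ ≤ ‖(μ E).re‖₊ + ‖(μ E).im‖₊ := Complex.norm_le_abs_re_add_abs_im (μ E)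
    exact_mod_cast h3
  rw [← SignedMeasure.totalVariation_eq_variation,
    ← SignedMeasure.totalVariation_eq_variation] at h
  have : IsFiniteMeasure (ComplexMeasure.re μ).totalVariation := by
    unfold SignedMeasure.totalVariation; infer_instance
  have : IsFiniteMeasure (ComplexMeasure.im μ).totalVariation := by
    unfold SignedMeasure.totalVariation; infer_instance
  exact isFiniteMeasure_of_le _ h

/-- A measure dominated by a finite regular measure is regular. -/
theorem regular_of_le {X : Type*} [TopologicalSpace X] [T2Space X] [MeasurableSpace X]
    [BorelSpace X] {m ρ : Measure X} [IsFiniteMeasure ρ] [ρ.Regular] (h : m ≤ ρ) :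
    m.Regular := by
  have : IsFiniteMeasure m := isFiniteMeasure_of_le ρ h
  have hO : m.OuterRegular := by
    refine ⟨fun A hA r hr => ?_⟩
    obtain ⟨U, hAU, hU, -, hlt⟩ := hA.exists_isOpen_sdiff_lt (μ := ρ) (by finiteness)
      (ε := r - m A) (tsub_pos_of_lt hr).ne'
    refine ⟨U, hAU, hU, ?_⟩
    calc m U = m A + m (U \ A) := by
          rw [← measure_union Set.disjoint_sdiff_right (hU.measurableSet.diff hA),
            Set.union_sdiff_cancel hAU]
      _ < m A + (r - m A) :=
          ENNReal.add_lt_add_left (by finiteness) (lt_of_le_of_lt (h _) hlt)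
      _ = r := add_tsub_cancel_of_le hr.le
  refine { hO with innerRegular := fun U hU r hr => ?_ }
  obtain ⟨K, hKU, hK, hlt⟩ := hU.measurableSet.exists_isCompact_sdiff_lt (μ := ρ)
    (by finiteness) (ε := m U - r) (tsub_pos_of_lt hr).ne'
  refine ⟨K, hKU, hK, ?_⟩
  by_contra hcon
  rw [not_lt] at hcon
  have : m U < m U := by
    calc m U = m K + m (U \ K) := by
          rw [← measure_union Set.disjoint_sdiff_right
            (hU.measurableSet.diff hK.isClosed.measurableSet), Set.union_sdiff_cancel hKU]
      _ < r + (m U - r) :=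
          ENNReal.add_lt_add_of_le_of_lt (by finiteness) hcon (lt_of_le_of_lt (h _) hlt)
      _ = m U := add_tsub_cancel_of_le hr.le
  exact lt_irrefl _ this

variable (X : Type*) [TopologicalSpace X] [T2Space X] [MeasurableSpace X] [BorelSpace X]

/-- The complex Borel measures on `X` whose total variation is regular. -/
def regularMeasures : Submodule ℂ (ComplexMeasure X) where
  carrier := {μ | μ.variation.Regular}
  zero_mem' := by
    simp only [Set.mem_ofPred_eq, VectorMeasure.variation_zero]
    infer_instance
  add_mem' := by
    intro μ ν hμ hν
    simp only [Set.mem_ofPred_eq] at hμ hν ⊢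
    have := isFiniteMeasure_variation μ
    have := isFiniteMeasure_variation ν
    have : (μ.variation + ν.variation).InnerRegular := inferInstance
    have : (μ.variation + ν.variation).Regular := inferInstance
    exact regular_of_le VectorMeasure.variation_add_le
  smul_mem' := by
    intro c μ hμ
    simp only [Set.mem_ofPred_eq] at hμ ⊢
    rw [VectorMeasure.variation_smul]
    infer_instance

/-- The total variation norm `‖μ‖ = |μ|(X)`. -/
instance : Norm (regularMeasures X) := ⟨fun μ => μ.1.variation.real Set.univ⟩

theorem normedSpaceCore : NormedSpace.Core ℂ (regularMeasures X) where
  norm_nonneg _ := measureReal_nonneg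
  norm_smul c μ := by
    change (c • μ.1).variation.real Set.univ = ‖c‖ * μ.1.variation.real Set.univ
    rw [VectorMeasure.variation_smul, measureReal_nnreal_smul_apply, coe_nnnorm]
  norm_triangle μ ν := by
    have := isFiniteMeasure_variation μ.1
    have := isFiniteMeasure_variation ν.1
    change (μ.1 + ν.1).variation.real Set.univ ≤
      μ.1.variation.real Set.univ + ν.1.variation.real Set.univ
    rw [← measureReal_add_apply]
    exact ENNReal.toReal_mono (by finiteness) (VectorMeasure.variation_add_le _)
  norm_eq_zero_iff μ := by
    have := isFiniteMeasure_variation μ.1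
    change μ.1.variation.real Set.univ = 0 ↔ μ = 0
    rw [measureReal_eq_zero_iff, Measure.measure_univ_eq_zero, VectorMeasure.variation_eq_zero,
      ZeroMemClass.coe_eq_zero]

/-- `M(X)`: the Banach space of regular complex Borel measures on `X`, with the total variation
norm. -/
def M : Type _ := regularMeasures X

instance : NormedAddCommGroup (M X) :=
  NormedAddCommGroup.ofCore (E := regularMeasures X) (normedSpaceCore X)

instance : NormedSpace ℂ (M X) :=
  letI : NormedAddCommGroup (regularMeasures X) := NormedAddCommGroup.ofCore (normedSpaceCore X)
  (NormedSpace.ofCore (normedSpaceCore X) : NormedSpace ℂ (regularMeasures X))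

variable {X} in
/-- An element of `M(X)` as a complex measure. -/
def M.meas (μ : M X) : ComplexMeasure X := Subtype.val (p := (· ∈ regularMeasures X)) μ

theorem M.regular_variation (μ : M X) : μ.meas.variation.Regular :=
  Subtype.property (p := (· ∈ regularMeasures X)) μ

theorem M.norm_eq (μ : M X) : ‖μ‖ = μ.meas.variation.real Set.univ := rfl

theorem M.meas_add (μ ν : M X) : (μ + ν).meas = μ.meas + ν.meas := rfl

theorem M.meas_smul (c : ℂ) (μ : M X) : (c • μ).meas = c • μ.meas := rfl

end Measures

/-- The integral `∫ f dμ` of a complex function against a complex measure. -/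
def cintegral {X : Type*} [MeasurableSpace X] (μ : ComplexMeasure X) (f : X → ℂ) : ℂ :=
  ∫ᵛ x, f x ∂[ContinuousLinearMap.mul ℝ ℂ; μ]

/-- The `w*`-topology `σ(M(X), C₀(X))`: the coarsest topology on `M(X)` making
`μ ↦ ∫ g dμ` continuous for every `g ∈ C₀(X)`. -/
abbrev weakStar (X : Type*) [TopologicalSpace X] [T2Space X] [MeasurableSpace X] [BorelSpace X] :
    TopologicalSpace (M X) :=
  ⨅ g : C₀(X, ℂ), TopologicalSpace.induced
    (fun μ : M X => cintegral μ.meas g) inferInstance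

section Spaces

variable (X Y : Type*) [TopologicalSpace X] [TopologicalSpace Y]

/-- `SC₀(X × Y)`: the bounded functions `f : X × Y → ℂ` (with the supremum norm) all of whose
partial functions are continuous and vanish at infinity. -/
def SC₀ : Submodule ℂ (lp (fun _ : X × Y => ℂ) ∞) where
  carrier := {f |
    (∀ x, Continuous (fun y => f (x, y)) ∧ Tendsto (fun y => f (x, y)) (cocompact Y) (𝓝 0)) ∧
    (∀ y, Continuous (fun x => f (x, y)) ∧ Tendsto (fun x => f (x, y)) (cocompact X) (𝓝 0))}
  zero_mem' := by
    constructor <;> intro _ <;> exact ⟨continuous_const, tendsto_const_nhds⟩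
  add_mem' := by
    intro f g hf hg
    refine ⟨fun x => ⟨(hf.1 x).1.add (hg.1 x).1, ?_⟩, fun y => ⟨(hf.2 y).1.add (hg.2 y).1, ?_⟩⟩
    · simpa using (hf.1 x).2.add (hg.1 x).2
    · simpa using (hf.2 y).2.add (hg.2 y).2
  smul_mem' := by
    intro c f hf
    refine ⟨fun x => ⟨(hf.1 x).1.const_smul c, ?_⟩, fun y => ⟨(hf.2 y).1.const_smul c, ?_⟩⟩
    · simpa using (hf.1 x).2.const_smul c
    · simpa using (hf.2 y).2.const_smul c

variable [T2Space X] [MeasurableSpace X] [BorelSpace X]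
  [T2Space Y] [MeasurableSpace Y] [BorelSpace Y]

/-- The bounded, separately `w*`-continuous bilinear forms on `M(X) × M(Y)`, with the norm
`sup {|Φ(μ, ν)| : ‖μ‖ ≤ 1, ‖ν‖ ≤ 1}` (the iterated operator norm). -/
def LwStar : Submodule ℂ (M X →L[ℂ] M Y →L[ℂ] ℂ) where
  carrier := {Φ |
    (∀ ν : M Y, Continuous[weakStar X, inferInstance] (fun μ : M X => Φ μ ν)) ∧
    (∀ μ : M X, Continuous[weakStar Y, inferInstance] (fun ν : M Y => Φ μ ν))}
  zero_mem' := by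
    constructor
    · intro _; let := weakStar X; exact continuous_const
    · intro _; let := weakStar Y; exact continuous_const
  add_mem' := by
    intro Φ Ψ hΦ hΨ
    refine ⟨fun ν => ?_, fun μ => ?_⟩
    · exact @Continuous.add _ _ _ _ _ (weakStar X) _ _ (hΦ.1 ν) (hΨ.1 ν)
    · exact @Continuous.add _ _ _ _ _ (weakStar Y) _ _ (hΦ.2 μ) (hΨ.2 μ)
  smul_mem' := by
    intro c Φ hΦ
    refine ⟨fun ν => ?_, fun μ => ?_⟩
    · exact @Continuous.const_smul _ _ _ _ _ _ (weakStar X) _ (hΦ.1 ν) c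
    · exact @Continuous.const_smul _ _ _ _ _ _ (weakStar Y) _ (hΦ.2 μ) c

end Spaces

end SepC0

end

/-!
The form `Φ_f(μ, ν) = ∫∫ f(x, y) dμ(x) dν(y)` takes the value `f(x, y)` at the point masses
`(δ_x, δ_y)`, so `f ↦ Φ_f` is isometric. Conversely, a `w*`-continuous functional on `M(X)` is
integration against some `g ∈ C₀(X)`, and `g` can be read off from the point masses. Applied in
each variable, this shows that a separately `w*`-continuous form `Φ` is `Φ_f` for
`f(x, y) = Φ(δ_x, δ_y)`.

The substance is that `Φ_f` is well defined and separately `w*`-continuous: the partial integrals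
of a separately continuous `f`, which need not be jointly continuous, must lie in `C₀` again, and
the order of integration must be irrelevant.

* After extending `f` by zero to the one-point compactifications, the Eberlein–Grothendieck argument
  (`exists_seq_tendsto_of_mem_closure`) shows that a map on `X` is continuous once it is
  sequentially continuous for pointwise convergence of the functions `f(x, ·)`
  (`continuous_of_forall_seq`). Bounded convergence provides the latter for
  `x ↦ ∫ f(x, y) dν(y)`, and also for `x ↦ f(x, ·) ∈ L¹(|ν|)` with the norm topology.
* Hence the image of `X` in `L¹(|ν|)` lies in a compact metric space. On `X × supp |ν|` the function
  `f` factors through this image, which makes it jointly measurable there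
  (`IsSepC₀.exists_measurable_eqOn_support`). As `|ν|` is regular, its support is conull, and the
  usual theorem of Fubini applies (`IsSepC₀.cintegral_cintegral_swap`). It turns `Φ_f(·, ν)` into
  integration against `x ↦ ∫ f(x, y) dν(y) ∈ C₀(X)`.
-/

noncomputable section

namespace SepC0

/-! ### Sequences in the closure of a set of separately continuous functions -/

section Compact

variable {X Y Z W : Type*} [TopologicalSpace Y]

/-- The finitely many functions `f x`, `x ∈ G`, are simultaneously approximated on a compact space
by their values on a finite set. -/
theorem exists_finset_forall_dist_lt [CompactSpace Y] [PseudoMetricSpace Z] {f : X → Y → Z}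
    (hf : ∀ x, Continuous (f x)) (G : Finset X) {ε : ℝ} (hε : 0 < ε) :
    ∃ D : Finset Y, ∀ y, ∃ d ∈ D, ∀ x ∈ G, dist (f x y) (f x d) < ε := by
  obtain ⟨D, hD⟩ := CompactSpace.elim_nhds_subcover
    (fun d => {y | ∀ x ∈ G, dist (f x y) (f x d) < ε}) (fun d => by
      rw [Set.ofPred_forall]
      simp only [Set.ofPred_forall]
      refine (biInter_finset_mem G).2 fun x _ => ?_
      exact ((hf x).continuousAt (x := d)) (Metric.ball_mem_nhds _ hε))
  refine ⟨D, fun y => ?_⟩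
  have hy : y ∈ (⊤ : Set Y) := trivial
  rw [← hD] at hy
  simpa using hy

variable [TopologicalSpace X]

/-- The Eberlein–Grothendieck argument: for a separately continuous function on a product of
compact spaces, a point in the closure of `S` is reached by a *sequence* in `S`, in the sense of
pointwise convergence of the partial functions. -/
theorem exists_seq_tendsto_of_mem_closure [CompactSpace X] [CompactSpace Y] [MetricSpace Z]
    {f : X → Y → Z} (hX : ∀ y, Continuous fun x => f x y) (hY : ∀ x, Continuous (f x))
    {S : Set X} {a : X} (ha : a ∈ closure S) :
    ∃ u : ℕ → X, (∀ n, u n ∈ S) ∧ ∀ y, Tendsto (fun n => f (u n) y) atTop (𝓝 (f a y)) := by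
  classical
  -- The terms of the sequence are chosen together with growing finite sets `D n ⊆ Y` on which
  -- `f (u n)` is close to `f a`, and which are fine enough for `f a` and the earlier `f (u i)`.
  obtain ⟨p, hp, hr⟩ := exists_seq_of_forall_finset_exists
    (α := Finset X × Finset Y × ℕ × X)
    (fun q => a ∈ q.1 ∧
      (∀ y, ∃ d ∈ q.2.1, ∀ x ∈ q.1, dist (f x y) (f x d) < 1 / ((q.2.2.1 : ℝ) + 1)) ∧
      q.2.2.2 ∈ S ∧ ∀ d ∈ q.2.1, dist (f q.2.2.2 d) (f a d) < 1 / ((q.2.2.1 : ℝ) + 1))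
    (fun q q' => q.2.2.2 ∈ q'.1 ∧ q.2.1 ⊆ q'.2.1 ∧ q.2.2.1 < q'.2.2.1) (by
      intro s _
      set G : Finset X := insert a (s.image fun q => q.2.2.2)
      set k : ℕ := s.sup (fun q => q.2.2.1) + 1
      have hk : (0 : ℝ) < 1 / ((k : ℝ) + 1) := by positivity
      obtain ⟨D₀, hD₀⟩ := exists_finset_forall_dist_lt hY G hk
      set D : Finset Y := D₀ ∪ s.biUnion fun q => q.2.1
      have hU : {x | ∀ d ∈ D, dist (f x d) (f a d) < 1 / ((k : ℝ) + 1)} ∈ 𝓝 a := by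
        simp only [Set.ofPred_forall]
        exact (biInter_finset_mem D).2 fun d _ =>
          ((hX d).continuousAt (x := a)) (Metric.ball_mem_nhds _ hk)
      obtain ⟨x, hx, hxS⟩ := mem_closure_iff_nhds.1 ha _ hU
      refine ⟨(G, D, k, x), ⟨Finset.mem_insert_self _ _, fun y => ?_, hxS, hx⟩,
        fun q hq => ⟨?_, ?_, ?_⟩⟩
      · obtain ⟨d, hd, h⟩ := hD₀ y
        exact ⟨d, Finset.mem_union_left _ hd, h⟩
      · exact Finset.mem_insert_of_mem (Finset.mem_image_of_mem _ hq)
      · exact (Finset.subset_biUnion_of_mem (fun q : Finset X × Finset Y × ℕ × X => q.2.1)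
          hq).trans Finset.subset_union_right
      · exact Nat.lt_succ_of_le
          (Finset.le_sup (f := fun q : Finset X × Finset Y × ℕ × X => q.2.2.1) hq))
  choose haG hnet hS hD using hp
  have hk : StrictMono fun n => (p n).2.2.1 := fun m n h => (hr m n h).2.2
  have hε : Tendsto (fun n => 1 / (((p n).2.2.1 : ℝ) + 1)) atTop (𝓝 0) :=
    (tendsto_one_div_add_atTop_nhds_zero_nat (𝕜 := ℝ)).comp hk.tendsto_atTop
  refine ⟨fun n => (p n).2.2.2, hS, fun y => ?_⟩
  set u : ℕ → X := fun n => (p n).2.2.2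
  choose d hdD hd using fun n => hnet n y
  -- `f (u n) → f a` at every point of `D`
  have hconvD (m : ℕ) : Tendsto (fun n => f (u n) (d m)) atTop (𝓝 (f a (d m))) := by
    rw [tendsto_iff_dist_tendsto_zero]
    refine squeeze_zero' (Eventually.of_forall fun _ => dist_nonneg) ?_ hε
    filter_upwards [eventually_gt_atTop m] with n hn
    exact (hD n _ ((hr m n hn).2.1 (hdD m))).le
  -- the points `d n` imitate `y` for `f a` and for all `f (u i)`
  have hcl {x : X} (hx : ∀ᶠ n in atTop, x ∈ (p n).1) :
      Tendsto (fun n => f x (d n)) atTop (𝓝 (f x y)) := by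
    rw [tendsto_iff_dist_tendsto_zero]
    refine squeeze_zero' (Eventually.of_forall fun _ => dist_nonneg) ?_ hε
    filter_upwards [hx] with n hn
    rw [dist_comm]
    exact (hd n x hn).le
  rw [tendsto_iff_ultrafilter]
  intro U hU
  obtain ⟨x', -, hx'⟩ := isCompact_univ.ultrafilter_le_nhds (U.map u) (by simp)
  obtain ⟨y', -, hy'⟩ := isCompact_univ.ultrafilter_le_nhds (U.map d) (by simp)
  have hu (z : Y) : Tendsto (fun n => f (u n) z) U (𝓝 (f x' z)) :=
    ((hX z).tendsto x').comp hx'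
  have hlim (x : X) : Tendsto (fun n => f x (d n)) U (𝓝 (f x y')) :=
    ((hY x).tendsto y').comp hy'
  have h1 : f a y' = f a y := tendsto_nhds_unique (hlim a)
    ((hcl (Eventually.of_forall haG)).mono_left hU)
  have h2 (i : ℕ) : f (u i) y' = f (u i) y := tendsto_nhds_unique (hlim (u i))
    ((hcl ((eventually_gt_atTop i).mono fun n hn => (hr i n hn).1)).mono_left hU)
  have h3 (m : ℕ) : f x' (d m) = f a (d m) :=
    tendsto_nhds_unique (hu (d m)) ((hconvD m).mono_left hU)
  have h4 : f x' y' = f a y' := tendsto_nhds_unique (hlim x') (by simpa only [h3] using hlim a)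
  have h5 : f x' y = f x' y' :=
    tendsto_nhds_unique (hu y) (by simpa only [h2] using hu y')
  rw [← h1, ← h4, ← h5]
  exact hu y

/-- A map on `X` is continuous as soon as it is sequentially continuous for the pointwise
convergence of the partial functions of a separately continuous function. -/
theorem continuous_of_forall_seq [CompactSpace X] [CompactSpace Y] [MetricSpace Z]
    [TopologicalSpace W] {f : X → Y → Z} (hX : ∀ y, Continuous fun x => f x y)
    (hY : ∀ x, Continuous (f x)) {F : X → W}
    (hF : ∀ (u : ℕ → X) (a : X), (∀ y, Tendsto (fun n => f (u n) y) atTop (𝓝 (f a y))) →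
      Tendsto (fun n => F (u n)) atTop (𝓝 (F a))) :
    Continuous F := by
  refine continuous_iff_isClosed.2 fun C hC => isClosed_of_closure_subset fun a ha => ?_
  obtain ⟨u, hu, hlim⟩ := exists_seq_tendsto_of_mem_closure hX hY ha
  exact hC.mem_of_tendsto (hF u a hlim) (Eventually.of_forall hu)

end Compact

/-! ### Integrals of bounded functions against complex measures -/

section Integral

variable {X Y : Type*} [MeasurableSpace X] [MeasurableSpace Y]

instance (μ : ComplexMeasure X) : IsFiniteMeasure μ.variation := isFiniteMeasure_variation μ

/-- A property of functions which holds for multiples of indicators and is stable under sums and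
under bounded pointwise limits of sequences holds for all bounded measurable functions. -/
theorem bounded_measurable_induction {P : (X → ℂ) → Prop}
    (indicator : ∀ (c : ℂ) (s : Set X), MeasurableSet s → P (s.indicator fun _ => c))
    (add : ∀ (f g : X → ℂ) (C D : ℝ), Measurable f → Measurable g → (∀ x, ‖f x‖ ≤ C) →
      (∀ x, ‖g x‖ ≤ D) → P f → P g → P fun x => f x + g x)
    (lim : ∀ (F : ℕ → X → ℂ) (f : X → ℂ) (C : ℝ), (∀ n, Measurable (F n)) →
      (∀ n x, ‖F n x‖ ≤ C) → (∀ x, Tendsto (fun n => F n x) atTop (𝓝 (f x))) →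
      (∀ n, P (F n)) → P f)
    {f : X → ℂ} (hf : Measurable f) {C : ℝ} (hC : ∀ x, ‖f x‖ ≤ C) : P f := by
  have hs (g : SimpleFunc X ℂ) : P g := by
    induction g using SimpleFunc.induction with
    | const c hs =>
      convert! indicator c _ hs
    | add _ hf hg =>
      rename_i f g _
      obtain ⟨C, hC⟩ := f.exists_forall_norm_le
      obtain ⟨D, hD⟩ := g.exists_forall_norm_le
      exact add f g C D f.measurable g.measurable hC hD hf hg
  have hf' : StronglyMeasurable f := hf.stronglyMeasurable
  have hC' (x : X) : ‖f x‖ ≤ max C 0 := (hC x).trans (le_max_left _ _)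
  exact lim (fun n => hf'.approxBounded (max C 0) n) f (max C 0)
    (fun n => (hf'.approxBounded _ n).measurable)
    (hf'.norm_approxBounded_le (le_max_right _ _))
    (fun x => hf'.tendsto_approxBounded_of_norm_le (hC' x)) (fun n => hs _)

theorem integrable_of_norm_le (μ : ComplexMeasure X) {f : X → ℂ} (hf : Measurable f) {C : ℝ}
    (hC : ∀ x, ‖f x‖ ≤ C) : μ.Integrable f :=
  Integrable.of_bound hf.aestronglyMeasurable C (Eventually.of_forall hC)

theorem cintegral_add {μ : ComplexMeasure X} {f g : X → ℂ} (hf : μ.Integrable f)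
    (hg : μ.Integrable g) :
    cintegral μ (fun x => f x + g x) = cintegral μ f + cintegral μ g :=
  VectorMeasure.integral_fun_add hf hg

theorem cintegral_const_mul (μ : ComplexMeasure X) (c : ℂ) (f : X → ℂ) :
    cintegral μ (fun x => c * f x) = c * cintegral μ f := by
  refine setToFun_smul _ (fun c s x => ?_) c f
  simp [VectorMeasure.transpose, mul_left_comm]

theorem cintegral_congr_ae {μ : ComplexMeasure X} {f g : X → ℂ} (h : f =ᵐ[μ.variation] g) :
    cintegral μ f = cintegral μ g :=
  VectorMeasure.integral_congr_ae h

theorem norm_cintegral_le (μ : ComplexMeasure X) {f : X → ℂ} {C : ℝ} (hC : ∀ x, ‖f x‖ ≤ C) :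
    ‖cintegral μ f‖ ≤ C * μ.variation.real Set.univ := by
  have h := VectorMeasure.norm_integral_le_of_norm_le_const (μ := μ)
    (B := ContinuousLinearMap.mul ℝ ℂ) (f := f) (Eventually.of_forall hC)
  rwa [ContinuousLinearMap.opNorm_mul, mul_one] at h

/-- Bounded convergence for the integral against a complex measure. -/
theorem tendsto_cintegral (μ : ComplexMeasure X) {F : ℕ → X → ℂ} {f : X → ℂ} {C : ℝ}
    (hF : ∀ n, Measurable (F n)) (hC : ∀ n x, ‖F n x‖ ≤ C)
    (h : ∀ x, Tendsto (fun n => F n x) atTop (𝓝 (f x))) :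
    Tendsto (fun n => cintegral μ (F n)) atTop (𝓝 (cintegral μ f)) :=
  VectorMeasure.tendsto_integral_filter_of_norm_le_const
    (Eventually.of_forall fun n => (hF n).aestronglyMeasurable)
    ⟨C, Eventually.of_forall fun n => Eventually.of_forall (hC n)⟩ (Eventually.of_forall h)

theorem cintegral_indicator (μ : ComplexMeasure X) (c : ℂ) {s : Set X} (hs : MeasurableSet s) :
    cintegral μ (s.indicator fun _ => c) = c * μ s :=
  VectorMeasure.integral_indicator_const c hs

theorem cintegral_zero (μ : ComplexMeasure X) : cintegral μ (fun _ => 0) = 0 :=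
  VectorMeasure.integral_zero

theorem cintegral_add_measure (μ ν : ComplexMeasure X) {f : X → ℂ} (hf : Measurable f) {C : ℝ}
    (hC : ∀ x, ‖f x‖ ≤ C) : cintegral (μ + ν) f = cintegral μ f + cintegral ν f :=
  VectorMeasure.integral_add_vectorMeasure (integrable_of_norm_le μ hf hC)
    (integrable_of_norm_le ν hf hC)

theorem cintegral_smul_measure (c : ℂ) (μ : ComplexMeasure X) {f : X → ℂ} (hf : Measurable f)
    {C : ℝ} (hC : ∀ x, ‖f x‖ ≤ C) : cintegral (c • μ) f = c * cintegral μ f := by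
  refine bounded_measurable_induction (P := fun f => cintegral (c • μ) f = c * cintegral μ f)
    (fun d s hs => ?_) (fun f g C D hf hg hC hD h1 h2 => ?_) (fun F f C hF hC h ih => ?_) hf hC
  · rw [cintegral_indicator _ _ hs, cintegral_indicator _ _ hs, smul_apply,
      smul_eq_mul]
    ring
  · rw [cintegral_add (integrable_of_norm_le _ hf hC) (integrable_of_norm_le _ hg hD),
      cintegral_add (integrable_of_norm_le _ hf hC) (integrable_of_norm_le _ hg hD), h1, h2,
      mul_add]
  · refine tendsto_nhds_unique (tendsto_cintegral _ hF hC h) ?_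
    simp only [ih]
    exact (tendsto_cintegral μ hF hC h).const_mul c

theorem cintegral_dirac [MeasurableSingletonClass X] (a : X) (f : X → ℂ) :
    cintegral (VectorMeasure.dirac a 1) f = f a := by
  simp [cintegral]

theorem measurable_cintegral (μ : ComplexMeasure X) {k : X × Y → ℂ} (hk : Measurable k) {C : ℝ}
    (hC : ∀ p, ‖k p‖ ≤ C) : Measurable fun y => cintegral μ fun x => k (x, y) := by
  refine bounded_measurable_induction
    (P := fun k : X × Y → ℂ => Measurable fun y => cintegral μ fun x => k (x, y))
    (fun c s hs => ?_) (fun f g C D hf hg hC hD h1 h2 => ?_) (fun F f C hF hC h ih => ?_) hk hC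
  · have (y : Y) : (fun x => s.indicator (fun _ => c) (x, y)) =
        ((fun x => (x, y)) ⁻¹' s).indicator fun _ => c := rfl
    simp only [this, cintegral_indicator μ c (measurable_prodMk_right hs)]
    exact ((VectorMeasure.stronglyMeasurable_vectorMeasure_prodMk_left (ν := μ)
      (measurable_swap hs)).measurable).const_mul c
  · have e (y : Y) : cintegral μ (fun x => f (x, y) + g (x, y)) =
        cintegral μ (fun x => f (x, y)) + cintegral μ fun x => g (x, y) :=
      cintegral_add (integrable_of_norm_le μ (hf.comp measurable_prodMk_right)
        (fun x => hC (x, y))) (integrable_of_norm_le μ (hg.comp measurable_prodMk_right)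
        (fun x => hD (x, y)))
    simp only [e]
    exact h1.add h2
  · exact measurable_of_tendsto_metrizable ih (tendsto_pi_nhds.2 fun y =>
      tendsto_cintegral μ (fun n => (hF n).comp measurable_prodMk_right) (fun n x => hC n (x, y))
        fun x => h (x, y))

/-- The two ways of integrating the measures of the sections of a measurable set agree, because
both define a measure with value `μ s * ν t` on the rectangles `s ×ˢ t`. -/
theorem cintegral_preimage_prodMk_swap (μ : ComplexMeasure X) (ν : ComplexMeasure Y)
    {s : Set (X × Y)} (hs : MeasurableSet s) :
    cintegral ν (fun y => μ ((fun x => (x, y)) ⁻¹' s)) =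
      cintegral μ (fun x => ν ((fun y => (x, y)) ⁻¹' s)) := by
  have hflip : (ContinuousLinearMap.mul ℝ ℂ).flip = ContinuousLinearMap.mul ℝ ℂ := by
    ext; simp
  have e1 := VectorMeasure.prod_apply_eq_integral (μ := μ) (ν := ν)
    (B := ContinuousLinearMap.mul ℝ ℂ) hs
  have e2 := VectorMeasure.prod_apply_eq_integral (μ := ν) (ν := μ)
    (B := ContinuousLinearMap.mul ℝ ℂ) (measurable_swap hs)
  have e3 : ν.prod μ (ContinuousLinearMap.mul ℝ ℂ) =
      (μ.prod ν (ContinuousLinearMap.mul ℝ ℂ)).map Prod.swap := by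
    refine VectorMeasure.prod_eq_of_forall_apply_prod fun t r ht hr => ?_
    rw [VectorMeasure.map_apply _ measurable_swap (ht.prod hr), Set.preimage_swap_prod,
      VectorMeasure.prod_apply, ContinuousLinearMap.mul_apply', ContinuousLinearMap.mul_apply',
      mul_comm]
  rw [e3, VectorMeasure.map_apply _ measurable_swap (measurable_swap hs), hflip] at e2
  rw [hflip] at e1
  exact e2.symm.trans e1

/-- Fubini's theorem for complex measures and jointly measurable bounded functions. -/
theorem cintegral_cintegral_swap (μ : ComplexMeasure X) (ν : ComplexMeasure Y) {k : X × Y → ℂ}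
    (hk : Measurable k) {C : ℝ} (hC : ∀ p, ‖k p‖ ≤ C) :
    cintegral ν (fun y => cintegral μ fun x => k (x, y)) =
      cintegral μ (fun x => cintegral ν fun y => k (x, y)) := by
  have mX {f : X × Y → ℂ} (hf : Measurable f) {C : ℝ} (hC : ∀ p, ‖f p‖ ≤ C) :
      Measurable fun x => cintegral ν fun y => f (x, y) :=
    measurable_cintegral ν (k := fun q : Y × X => f q.swap) (hf.comp measurable_swap)
      fun q => hC q.swap
  refine bounded_measurable_induction (P := fun k : X × Y → ℂ =>
      cintegral ν (fun y => cintegral μ fun x => k (x, y)) =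
        cintegral μ (fun x => cintegral ν fun y => k (x, y)))
    (fun c s hs => ?_) (fun f g C D hf hg hC hD h1 h2 => ?_) (fun F f C hF hC h ih => ?_) hk hC
  · have h1 (y : Y) : (fun x => s.indicator (fun _ => c) (x, y)) =
        ((fun x => (x, y)) ⁻¹' s).indicator fun _ => c := rfl
    have h2 (x : X) : (fun y => s.indicator (fun _ => c) (x, y)) =
        ((fun y => (x, y)) ⁻¹' s).indicator fun _ => c := rfl
    simp only [h1, h2, cintegral_indicator μ c (measurable_prodMk_right hs),
      cintegral_indicator ν c (measurable_prodMk_left hs), cintegral_const_mul]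
    rw [cintegral_preimage_prodMk_swap μ ν hs]
  · have eX (y : Y) : cintegral μ (fun x => f (x, y) + g (x, y)) =
        cintegral μ (fun x => f (x, y)) + cintegral μ fun x => g (x, y) :=
      cintegral_add (integrable_of_norm_le μ (hf.comp measurable_prodMk_right)
        (fun x => hC (x, y))) (integrable_of_norm_le μ (hg.comp measurable_prodMk_right)
        (fun x => hD (x, y)))
    have eY (x : X) : cintegral ν (fun y => f (x, y) + g (x, y)) =
        cintegral ν (fun y => f (x, y)) + cintegral ν fun y => g (x, y) :=
      cintegral_add (integrable_of_norm_le ν (hf.comp measurable_prodMk_left)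
        (fun y => hC (x, y))) (integrable_of_norm_le ν (hg.comp measurable_prodMk_left)
        (fun y => hD (x, y)))
    simp only [eX, eY]
    rw [cintegral_add (integrable_of_norm_le ν (measurable_cintegral μ hf hC)
        fun y => norm_cintegral_le μ fun x => hC (x, y))
      (integrable_of_norm_le ν (measurable_cintegral μ hg hD)
        fun y => norm_cintegral_le μ fun x => hD (x, y)),
      cintegral_add (integrable_of_norm_le μ (mX hf hC)
        fun x => norm_cintegral_le ν fun y => hC (x, y))
      (integrable_of_norm_le μ (mX hg hD)
        fun x => norm_cintegral_le ν fun y => hD (x, y)), h1, h2]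
  · have l1 : Tendsto (fun n => cintegral ν fun y => cintegral μ fun x => F n (x, y)) atTop
        (𝓝 (cintegral ν fun y => cintegral μ fun x => f (x, y))) :=
      tendsto_cintegral ν (fun n => measurable_cintegral μ (hF n) (hC n))
        (fun n y => norm_cintegral_le μ fun x => hC n (x, y)) fun y =>
        tendsto_cintegral μ (fun n => (hF n).comp measurable_prodMk_right)
          (fun n x => hC n (x, y)) fun x => h (x, y)
    have l2 : Tendsto (fun n => cintegral μ fun x => cintegral ν fun y => F n (x, y)) atTop
        (𝓝 (cintegral μ fun x => cintegral ν fun y => f (x, y))) :=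
      tendsto_cintegral μ (fun n => mX (hF n) (hC n))
        (fun n x => norm_cintegral_le ν fun y => hC n (x, y)) fun x =>
        tendsto_cintegral ν (fun n => (hF n).comp measurable_prodMk_left)
          (fun n y => hC n (x, y)) fun y => h (x, y)
    simp only [ih] at l1
    exact tendsto_nhds_unique l1 l2

end Integral

/-! ### Separately continuous functions vanishing at infinity -/

section Extension

variable {X Y : Type*} {f : X × Y → ℂ}

/-- The extension of `f` by zero to the product of the one-point compactifications. -/
def extend (f : X × Y → ℂ) (p : OnePoint X) (q : OnePoint Y) : ℂ :=
  p.elim 0 fun x => q.elim 0 fun y => f (x, y)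

@[simp] theorem extend_coe_coe (x : X) (y : Y) : extend f x y = f (x, y) := rfl

@[simp] theorem extend_infty_left (q : OnePoint Y) : extend f OnePoint.infty q = 0 := rfl

@[simp] theorem extend_infty_right (p : OnePoint X) : extend f p OnePoint.infty = 0 := by
  induction p using OnePoint.rec <;> rfl

theorem norm_extend_le {C : ℝ} (hC₀ : 0 ≤ C) (hC : ∀ p, ‖f p‖ ≤ C) (p : OnePoint X)
    (q : OnePoint Y) : ‖extend f p q‖ ≤ C := by
  induction p using OnePoint.rec with
  | infty => simpa
  | coe x =>
    induction q using OnePoint.rec with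
    | infty => simpa
    | coe y => exact hC _

variable [TopologicalSpace X] [TopologicalSpace Y]

/-- All partial functions of `f` are continuous and vanish at infinity. -/
def IsSepC₀ (f : X × Y → ℂ) : Prop :=
  (∀ x, Continuous (fun y => f (x, y)) ∧ Tendsto (fun y => f (x, y)) (cocompact Y) (𝓝 0)) ∧
  (∀ y, Continuous (fun x => f (x, y)) ∧ Tendsto (fun x => f (x, y)) (cocompact X) (𝓝 0))

theorem IsSepC₀.swap (hf : IsSepC₀ f) : IsSepC₀ fun q : Y × X => f q.swap :=
  ⟨hf.2, hf.1⟩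

theorem IsSepC₀.continuous_extend_left [T2Space X] (hf : IsSepC₀ f) (q : OnePoint Y) :
    Continuous fun p : OnePoint X => extend f p q := by
  induction q using OnePoint.rec with
  | infty => simpa using continuous_const
  | coe y =>
    rw [OnePoint.continuous_iff, coclosedCompact_eq_cocompact]
    exact ⟨(hf.2 y).2, (hf.2 y).1⟩

theorem IsSepC₀.continuous_extend_right [T2Space Y] (hf : IsSepC₀ f) (p : OnePoint X) :
    Continuous (extend f p) := by
  induction p using OnePoint.rec with
  | infty => exact continuous_const
  | coe x =>
    rw [OnePoint.continuous_iff, coclosedCompact_eq_cocompact]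
    exact ⟨(hf.1 x).2, (hf.1 x).1⟩

theorem IsSepC₀.continuous_extend_coe [T2Space Y] (hf : IsSepC₀ f) (p : OnePoint X) :
    Continuous fun y : Y => extend f p y :=
  (hf.continuous_extend_right p).comp OnePoint.continuous_coe

variable [T2Space X] [T2Space Y] [MeasurableSpace Y]

/-- For a finite measure `ν`, the map `x ↦ f (x, ·)` into `L¹(ν)` is continuous for the norm. -/
theorem IsSepC₀.continuous_toLp (hf : IsSepC₀ f) (ν : Measure Y) {C : ℝ} (hC₀ : 0 ≤ C)
    (hC : ∀ p, ‖f p‖ ≤ C) [IsFiniteMeasure ν]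
    (hm : ∀ p : OnePoint X, MemLp (fun y : Y => extend f p y) 1 ν) :
    Continuous fun p => (hm p).toLp := by
  refine continuous_of_forall_seq hf.continuous_extend_left hf.continuous_extend_right
    fun u a h => ?_
  rw [Lp.tendsto_Lp_iff_tendsto_eLpNorm'']
  simp only [eLpNorm_one_eq_lintegral_enorm, Pi.sub_apply]
  simp only [← ofReal_norm]
  exact tendsto_lintegral_norm_of_dominated_convergence (bound := fun _ => C)
    (fun n => (hm _).1) (integrable_const C).2
    (fun n => Eventually.of_forall fun y => norm_extend_le hC₀ hC _ _)
    (Eventually.of_forall fun y => h y)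

variable [BorelSpace Y]

/-- The partial integrals of `f` are continuous on the one-point compactification. -/
theorem IsSepC₀.continuous_cintegral_extend (hf : IsSepC₀ f) {C : ℝ} (hC₀ : 0 ≤ C)
    (hC : ∀ p, ‖f p‖ ≤ C) (ν : ComplexMeasure Y) :
    Continuous fun p : OnePoint X => cintegral ν fun y => extend f p y :=
  continuous_of_forall_seq hf.continuous_extend_left hf.continuous_extend_right fun _ _ h =>
    tendsto_cintegral ν (fun _ => (hf.continuous_extend_coe _).measurable)
      (fun _ _ => norm_extend_le hC₀ hC _ _) fun y => h y

/-- The partial integral of a bounded separately `C₀` function is an element of `C₀(X)`. -/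
def IsSepC₀.integralRight (hf : IsSepC₀ f) {C : ℝ} (hC₀ : 0 ≤ C) (hC : ∀ p, ‖f p‖ ≤ C)
    (ν : ComplexMeasure Y) : C₀(X, ℂ) where
  toFun x := cintegral ν fun y => f (x, y)
  continuous_toFun := ((OnePoint.continuous_iff _).1
    (hf.continuous_cintegral_extend hC₀ hC ν)).2
  zero_at_infty' := by
    have h := ((OnePoint.continuous_iff _).1 (hf.continuous_cintegral_extend hC₀ hC ν)).1
    simpa [coclosedCompact_eq_cocompact, cintegral_zero] using h

/-- On `X × supp ν`, a bounded separately `C₀` function is jointly Borel measurable. The reason is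
that there it factors through the image of `X` in `L¹(ν)`, which lies in a compact metric space,
and that functions which are continuous in a variable from such a space and measurable in the other
variable are jointly measurable. -/
theorem IsSepC₀.exists_measurable_eqOn_support [MeasurableSpace X] [BorelSpace X]
    (hf : IsSepC₀ f) (ν : Measure Y) {C : ℝ} (hC₀ : 0 ≤ C)
    (hC : ∀ p, ‖f p‖ ≤ C) [IsFiniteMeasure ν] :
    ∃ k : X × Y → ℂ, Measurable k ∧ (∀ p, ‖k p‖ ≤ C) ∧
      ∀ x, ∀ y ∈ ν.support, k (x, y) = f (x, y) := by
  have hm (p : OnePoint X) : MemLp (fun y : Y => extend f p y) 1 ν :=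
    MemLp.of_bound (hf.continuous_extend_coe p).measurable.aestronglyMeasurable C
      (Eventually.of_forall fun y => norm_extend_le hC₀ hC p y)
  set π : OnePoint X → Lp ℂ 1 ν := fun p => (hm p).toLp
  have hπ : Continuous π := hf.continuous_toLp ν hC₀ hC hm
  have heq {p q : OnePoint X} (hpq : π p = π q) {y : Y} (hy : y ∈ ν.support) :
      extend f p y = extend f q y := by
    have h := (MemLp.toLp_eq_toLp_iff (hm p) (hm q)).1 hpq
    exact Measure.support_subset_of_isClosed
      (isClosed_eq (hf.continuous_extend_coe p) (hf.continuous_extend_coe q)) h hy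
  have : CompactSpace (Set.range π) := isCompact_iff_compactSpace.1 (isCompact_range hπ)
  set ρ : OnePoint X → Set.range π := Set.rangeFactorization π
  have hρc : Continuous ρ := hπ.subtype_mk _
  have hρs : Function.Surjective ρ := Set.rangeFactorization_surjective
  have hρ : IsQuotientMap ρ := IsQuotientMap.of_surjective_continuous hρs hρc
  set u : Set.range π → Y → ℂ := fun t =>
    ν.support.indicator fun y => extend f (Function.surjInv hρs t) y
  let _ : MeasurableSpace (Set.range π) := borel _
  have : BorelSpace (Set.range π) := ⟨rfl⟩
  have hu : Measurable (Function.uncurry u) := by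
    refine measurable_uncurry_of_continuous_of_measurable (fun y => ?_) fun t =>
      (hf.continuous_extend_coe _).measurable.indicator Measure.isClosed_support.measurableSet
    by_cases hy : y ∈ ν.support
    · refine hρ.continuous_iff.2 ?_
      convert! hf.continuous_extend_left (y : OnePoint Y) using 2 with p
      simp only [Function.comp_apply, u, Set.indicator_of_mem hy]
      exact heq (congrArg Subtype.val (Function.surjInv_eq hρs (ρ p))) hy
    · simpa only [u, Set.indicator_of_notMem hy] using continuous_const
  refine ⟨fun p => u (ρ p.1) p.2, ?_, fun p => ?_, fun x y hy => ?_⟩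
  · exact hu.comp (((hρc.comp OnePoint.continuous_coe).measurable.comp measurable_fst).prodMk
      measurable_snd)
  · exact (norm_indicator_le_norm_self _ _).trans (norm_extend_le hC₀ hC _ _)
  · simp only [u, Set.indicator_of_mem hy]
    rw [heq (congrArg Subtype.val (Function.surjInv_eq hρs (ρ x))) hy, extend_coe_coe]

/-- Fubini's theorem for bounded separately `C₀` functions. -/
theorem IsSepC₀.cintegral_cintegral_swap [MeasurableSpace X] [BorelSpace X]
    (hf : IsSepC₀ f) {C : ℝ} (hC₀ : 0 ≤ C) (hC : ∀ p, ‖f p‖ ≤ C) (μ : ComplexMeasure X)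
    (ν : ComplexMeasure Y) [ν.variation.Regular] :
    cintegral ν (fun y => cintegral μ fun x => f (x, y)) =
      cintegral μ (fun x => cintegral ν fun y => f (x, y)) := by
  obtain ⟨k, hk, hkC, hkf⟩ := hf.exists_measurable_eqOn_support ν.variation hC₀ hC
  have hν : ∀ᵐ y ∂ν.variation, y ∈ ν.variation.support := Measure.support_mem_ae_of_regular
  calc cintegral ν (fun y => cintegral μ fun x => f (x, y))
      = cintegral ν (fun y => cintegral μ fun x => k (x, y)) :=
        cintegral_congr_ae (hν.mono fun y hy => by simp only [hkf _ y hy])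
    _ = cintegral μ (fun x => cintegral ν fun y => k (x, y)) :=
        SepC0.cintegral_cintegral_swap μ ν hk hkC
    _ = cintegral μ (fun x => cintegral ν fun y => f (x, y)) :=
        congrArg _ (funext fun x => cintegral_congr_ae (hν.mono fun y hy => hkf x y hy))

end Extension

/-! ### Point masses and weak-star continuous functionals -/

section WeakStar

theorem norm_zeroAtInfty_apply_le {X : Type*} [TopologicalSpace X] (g : C₀(X, ℂ))
    (x : X) : ‖g x‖ ≤ ‖g‖ :=
  g.toBCF.norm_coe_le_norm x

variable {X : Type*} [TopologicalSpace X] [T2Space X] [MeasurableSpace X] [BorelSpace X]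

theorem regular_dirac (a : X) : (Measure.dirac a).Regular := by
  have hO : (Measure.dirac a).OuterRegular := by
    refine ⟨fun A hA r hr => ?_⟩
    by_cases ha : a ∈ A
    · refine ⟨Set.univ, Set.subset_univ _, isOpen_univ, ?_⟩
      rwa [Measure.dirac_apply_of_mem (Set.mem_univ a), ← Measure.dirac_apply_of_mem ha]
    · refine ⟨{a}ᶜ, fun x hx h => ha (h ▸ hx), isOpen_compl_singleton, ?_⟩
      rw [Measure.dirac_apply' _ isOpen_compl_singleton.measurableSet]
      simpa using hr.trans_le' zero_le
  refine { hO with innerRegular := fun U hU r hr => ?_ }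
  rw [Measure.dirac_apply' _ hU.measurableSet] at hr
  have ha : a ∈ U := by
    by_contra h
    simp [h] at hr
  refine ⟨{a}, Set.singleton_subset_iff.2 ha, isCompact_singleton, ?_⟩
  rw [Measure.dirac_apply_of_mem (Set.mem_singleton a)]
  simpa [ha] using hr

/-- The point mass at `a` as an element of `M(X)`. -/
def M.dirac (a : X) : M X :=
  (⟨VectorMeasure.dirac a 1, by
    change (VectorMeasure.dirac a (1 : ℂ)).variation.Regular
    simpa using regular_dirac a⟩ : regularMeasures X)

theorem M.meas_dirac (a : X) : (M.dirac a).meas = VectorMeasure.dirac a 1 := rfl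

theorem M.norm_dirac (a : X) : ‖M.dirac a‖ = 1 := by
  simp [M.norm_eq, M.meas_dirac]

theorem cintegral_meas_dirac (a : X) (f : X → ℂ) : cintegral (M.dirac a).meas f = f a :=
  cintegral_dirac a f

theorem norm_cintegral_meas_le (μ : M X) {f : X → ℂ} {C : ℝ} (hC : ∀ x, ‖f x‖ ≤ C) :
    ‖cintegral μ.meas f‖ ≤ C * ‖μ‖ :=
  norm_cintegral_le μ.meas hC

/-- The pairing `g ↦ (μ ↦ ∫ g dμ)` of `C₀(X)` with `M(X)`. -/
def pairing : C₀(X, ℂ) →ₗ[ℂ] M X →ₗ[ℂ] ℂ where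
  toFun g :=
    { toFun := fun μ => cintegral μ.meas g
      map_add' := fun μ ν => by
        rw [M.meas_add]
        exact cintegral_add_measure _ _ (map_continuous g).measurable (norm_zeroAtInfty_apply_le g)
      map_smul' := fun c μ => by
        rw [M.meas_smul]
        exact cintegral_smul_measure _ _ (map_continuous g).measurable
          (norm_zeroAtInfty_apply_le g) }
  map_add' g h := LinearMap.ext fun μ => cintegral_add
    (integrable_of_norm_le _ (map_continuous g).measurable (norm_zeroAtInfty_apply_le g))
    (integrable_of_norm_le _ (map_continuous h).measurable (norm_zeroAtInfty_apply_le h))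
  map_smul' c g := LinearMap.ext fun μ => cintegral_const_mul μ.meas c g

theorem pairing_apply (g : C₀(X, ℂ)) (μ : M X) : pairing g μ = cintegral μ.meas g := rfl

theorem continuous_weakStar_cintegral (g : C₀(X, ℂ)) :
    Continuous[weakStar X, inferInstance] fun μ : M X => cintegral μ.meas g :=
  continuous_iInf_dom continuous_induced_dom

/-- The `w*`-continuous linear functionals on `M(X)` are the integrals of elements of `C₀(X)`. -/
theorem exists_eq_cintegral_of_continuous_weakStar (φ : M X →ₗ[ℂ] ℂ)
    (hφ : Continuous[weakStar X, inferInstance] φ) :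
    ∃ g : C₀(X, ℂ), ∀ μ : M X, φ μ = cintegral μ.meas g := by
  have h : φ ∈ Submodule.span ℂ (Set.range (pairing (X := X))) :=
    (LinearMap.mem_span_iff_continuous φ).2 hφ
  rw [← LinearMap.coe_range, Submodule.span_eq] at h
  obtain ⟨g, rfl⟩ := h
  exact ⟨g, fun μ => rfl⟩

end WeakStar

/-! ### The bilinear form of a separately `C₀` function -/

section Form

variable {X Y : Type*} [TopologicalSpace X] [TopologicalSpace Y]

theorem SC₀.isSepC₀ (f : SC₀ X Y) : IsSepC₀ f.1 := f.2

theorem SC₀.norm_apply_le (f : SC₀ X Y) (p : X × Y) : ‖f.1 p‖ ≤ ‖f‖ :=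
  lp.norm_apply_le_norm (by simp) f.1 p

variable [MeasurableSpace X] [BorelSpace X]

theorem SC₀.measurable_left (f : SC₀ X Y) (y : Y) : Measurable fun x => f.1 (x, y) :=
  ((SC₀.isSepC₀ f).2 y).1.measurable

variable [T2Space X]

theorem SC₀.integrable_left (f : SC₀ X Y) (μ : M X) (y : Y) :
    μ.meas.Integrable fun x => f.1 (x, y) :=
  integrable_of_norm_le _ (SC₀.measurable_left f y) fun x => SC₀.norm_apply_le f (x, y)

variable [T2Space Y]

/-- The function `y ↦ ∫ f(x, y) dμ(x)` in `C₀(Y)`. -/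
def SC₀.integralLeft (f : SC₀ X Y) (μ : M X) : C₀(Y, ℂ) :=
  (SC₀.isSepC₀ f).swap.integralRight (norm_nonneg f) (fun q => SC₀.norm_apply_le f q.swap) μ.meas

theorem SC₀.integralLeft_apply (f : SC₀ X Y) (μ : M X) (y : Y) :
    SC₀.integralLeft f μ y = cintegral μ.meas fun x => f.1 (x, y) := rfl

theorem SC₀.integralLeft_add_measure (f : SC₀ X Y) (μ μ' : M X) :
    SC₀.integralLeft f (μ + μ') = SC₀.integralLeft f μ + SC₀.integralLeft f μ' :=
  ZeroAtInftyContinuousMap.ext fun y =>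
    cintegral_add_measure μ.meas μ'.meas (SC₀.measurable_left f y) fun x => SC₀.norm_apply_le f (x, y)

theorem SC₀.integralLeft_smul_measure (f : SC₀ X Y) (c : ℂ) (μ : M X) :
    SC₀.integralLeft f (c • μ) = c • SC₀.integralLeft f μ :=
  ZeroAtInftyContinuousMap.ext fun y => cintegral_smul_measure c μ.meas (SC₀.measurable_left f y)
    fun x => SC₀.norm_apply_le f (x, y)

theorem SC₀.integralLeft_add (f g : SC₀ X Y) (μ : M X) :
    SC₀.integralLeft (f + g) μ = SC₀.integralLeft f μ + SC₀.integralLeft g μ :=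
  ZeroAtInftyContinuousMap.ext fun y =>
    cintegral_add (SC₀.integrable_left f μ y) (SC₀.integrable_left g μ y)

theorem SC₀.integralLeft_smul (c : ℂ) (f : SC₀ X Y) (μ : M X) :
    SC₀.integralLeft (c • f) μ = c • SC₀.integralLeft f μ :=
  ZeroAtInftyContinuousMap.ext fun y => cintegral_const_mul μ.meas c fun x => f.1 (x, y)

variable [MeasurableSpace Y] [BorelSpace Y]

/-- The function `x ↦ ∫ f(x, y) dν(y)` in `C₀(X)`. -/
def SC₀.integralRight (f : SC₀ X Y) (ν : M Y) : C₀(X, ℂ) :=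
  (SC₀.isSepC₀ f).integralRight (norm_nonneg f) (SC₀.norm_apply_le f) ν.meas

theorem integrable_zeroAtInfty (g : C₀(Y, ℂ)) (ν : M Y) : ν.meas.Integrable g :=
  integrable_of_norm_le _ (map_continuous g).measurable (norm_zeroAtInfty_apply_le g)

/-- The iterated integral, in either order, as a form on `M(X) × M(Y)`. -/
theorem SC₀.pairing_integralLeft (f : SC₀ X Y) (μ : M X) (ν : M Y) :
    pairing (SC₀.integralLeft f μ) ν = pairing (SC₀.integralRight f ν) μ := by
  have := ν.regular_variation
  exact (SC₀.isSepC₀ f).cintegral_cintegral_swap (norm_nonneg f) (SC₀.norm_apply_le f)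
    μ.meas ν.meas

theorem SC₀.norm_pairing_le (f : SC₀ X Y) (μ : M X) (ν : M Y) :
    ‖pairing (SC₀.integralLeft f μ) ν‖ ≤ ‖f‖ * ‖μ‖ * ‖ν‖ :=
  norm_cintegral_meas_le ν fun y => norm_cintegral_meas_le μ fun x => SC₀.norm_apply_le f (x, y)

/-- The bounded bilinear form `Φ_f(μ, ν) = ∫∫ f(x, y) dμ(x) dν(y)`. -/
def SC₀.form (f : SC₀ X Y) : M X →L[ℂ] M Y →L[ℂ] ℂ :=
  LinearMap.mkContinuous₂
    { toFun := fun μ => pairing (SC₀.integralLeft f μ)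
      map_add' := fun μ μ' => by rw [SC₀.integralLeft_add_measure f, map_add]
      map_smul' := fun c μ => by rw [SC₀.integralLeft_smul_measure f, map_smul, RingHom.id_apply] }
    ‖f‖ (SC₀.norm_pairing_le f)

theorem SC₀.form_apply (f : SC₀ X Y) (μ : M X) (ν : M Y) :
    SC₀.form f μ ν = pairing (SC₀.integralLeft f μ) ν := rfl

theorem SC₀.form_mem (f : SC₀ X Y) : SC₀.form f ∈ LwStar X Y := by
  refine ⟨fun ν => ?_, fun μ => continuous_weakStar_cintegral (SC₀.integralLeft f μ)⟩
  simp only [SC₀.form_apply, SC₀.pairing_integralLeft f]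
  exact continuous_weakStar_cintegral (SC₀.integralRight f ν)

theorem SC₀.form_dirac (f : SC₀ X Y) (x : X) (y : Y) :
    SC₀.form f (M.dirac x) (M.dirac y) = f.1 (x, y) := by
  rw [SC₀.form_apply, pairing_apply, cintegral_meas_dirac, SC₀.integralLeft_apply,
    cintegral_meas_dirac]

theorem SC₀.norm_form (f : SC₀ X Y) : ‖SC₀.form f‖ = ‖f‖ := by
  refine le_antisymm (LinearMap.mkContinuous₂_norm_le _ (norm_nonneg f) (SC₀.norm_pairing_le f)) ?_
  refine lp.norm_le_of_forall_le (norm_nonneg _) fun p => ?_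
  have h := (SC₀.form f).le_opNorm₂ (M.dirac p.1) (M.dirac p.2)
  rwa [SC₀.form_dirac f, M.norm_dirac, M.norm_dirac, mul_one, mul_one] at h

/-- The map `f ↦ Φ_f` as a linear isometry into the separately `w*`-continuous bilinear forms. -/
def formₗᵢ : SC₀ X Y →ₗᵢ[ℂ] LwStar X Y where
  toFun f := ⟨SC₀.form f, SC₀.form_mem f⟩
  map_add' f g := by
    ext μ ν
    change pairing (SC₀.integralLeft (f + g) μ) ν = _
    rw [SC₀.integralLeft_add, map_add]
    rfl
  map_smul' c f := by
    ext μ ν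
    change pairing (SC₀.integralLeft (c • f) μ) ν = _
    rw [SC₀.integralLeft_smul, map_smul]
    rfl
  norm_map' f := SC₀.norm_form f

/-- Every separately `w*`-continuous bilinear form `Φ` is `Φ_f` for `f(x, y) = Φ(δ_x, δ_y)`. -/
theorem surjective_formₗᵢ : Function.Surjective (formₗᵢ (X := X) (Y := Y)) := by
  intro Φ
  have hleft (ν : M Y) : ∃ g : C₀(X, ℂ), ∀ μ : M X, Φ.1 μ ν = cintegral μ.meas g :=
    exists_eq_cintegral_of_continuous_weakStar (Φ.1.flip ν : M X →ₗ[ℂ] ℂ) (Φ.2.1 ν)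
  have hright (μ : M X) : ∃ h : C₀(Y, ℂ), ∀ ν : M Y, Φ.1 μ ν = cintegral ν.meas h :=
    exists_eq_cintegral_of_continuous_weakStar (Φ.1 μ : M Y →ₗ[ℂ] ℂ) (Φ.2.2 μ)
  choose g hg using hleft
  choose h hh using hright
  have hg' (ν : M Y) (x : X) : g ν x = Φ.1 (M.dirac x) ν := by
    rw [hg, cintegral_meas_dirac]
  have hh' (μ : M X) (y : Y) : h μ y = Φ.1 μ (M.dirac y) := by
    rw [hh, cintegral_meas_dirac]
  have hmem : Memℓp (fun p : X × Y => Φ.1 (M.dirac p.1) (M.dirac p.2)) ∞ := by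
    refine memℓp_infty ⟨‖Φ.1‖, ?_⟩
    rintro - ⟨p, rfl⟩
    simpa [M.norm_dirac] using Φ.1.le_opNorm₂ (M.dirac p.1) (M.dirac p.2)
  set F : lp (fun _ : X × Y => ℂ) ∞ := ⟨_, hmem⟩
  have hFg (x : X) (y : Y) : F (x, y) = g (M.dirac y) x := (hg' _ _).symm
  have hFh (x : X) (y : Y) : F (x, y) = h (M.dirac x) y := (hh' _ _).symm
  have hF : F ∈ SC₀ X Y := by
    refine ⟨fun x => ?_, fun y => ?_⟩
    · simp only [hFh]
      exact ⟨map_continuous _, (h _).zero_at_infty'⟩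
    · simp only [hFg]
      exact ⟨map_continuous _, (g _).zero_at_infty'⟩
  refine ⟨⟨F, hF⟩, Subtype.ext <| ContinuousLinearMap.ext fun μ =>
    ContinuousLinearMap.ext fun ν => ?_⟩
  change cintegral ν.meas (fun y => cintegral μ.meas fun x => F (x, y)) = Φ.1 μ ν
  simp only [hFg, ← hg, ← hh', ← hh]

end Form

end SepC0

end

theorem proposition2p3 {X Y : Type*}
    [TopologicalSpace X] [LocallyCompactSpace X] [T2Space X] [MeasurableSpace X] [BorelSpace X]
    [TopologicalSpace Y] [LocallyCompactSpace Y] [T2Space Y] [MeasurableSpace Y] [BorelSpace Y] :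
    ∃ T : SepC0.SC₀ X Y ≃ₗᵢ[ℂ] SepC0.LwStar X Y,
      ∀ (f : SepC0.SC₀ X Y) (μ : SepC0.M X) (ν : SepC0.M Y),
        (∀ y : Y, μ.meas.Integrable (fun x => f.1 (x, y))) ∧
        ν.meas.Integrable (fun y => SepC0.cintegral μ.meas (fun x => f.1 (x, y))) ∧
        (T f).1 μ ν =
          SepC0.cintegral ν.meas (fun y => SepC0.cintegral μ.meas (fun x => f.1 (x, y))) :=
  ⟨LinearIsometryEquiv.ofSurjective SepC0.formₗᵢ SepC0.surjective_formₗᵢ, fun f μ ν =>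
    ⟨SepC0.SC₀.integrable_left f μ,
      SepC0.integrable_zeroAtInfty (SepC0.SC₀.integralLeft f μ) ν, rfl⟩⟩
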